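/- **Notation.** For real numbers $a<b$ and a finite-dimensional real normed space $E$, let $NBV([a,b],E)$ be the real vector space of all functions $g:[a,b]\to E$ of bounded variation that are left-continuous on $[a,b)$ and satisfy $g(a)=0$, normed by the total variation $\Vert g\Vert_{BV}=V_a^b(g)$. For $\gamma\in NBV([a,b],\mathbb R)$ let $\mu[\gamma]$ be the signed Borel measure on $[a,b]$ with $\mu[\gamma]([\alpha,\beta))=\gamma(\beta)-\gamma(\alpha)$ for $a\le\alpha<\beta<b$ and $\mu[\gamma]([\alpha,b])=\gamma(b)-\gamma(\alpha)$ for $a\le\alpha<b$, and put $\int_a^b d\gamma(\theta)\,\varphi(\theta):=\int_{[a,b]}\varphi\,d\mu[\gamma]$. Let $r>0$ and let $n$ be a natural number. Give $\mathbb R^n$, with canonical basis $(e_k)$, the maximum norm, and its dual $\mathbb R^{n*}$, with dual basis $(e_k^*)$, the dual norm $\Vert\sum_k p_ke_k^*\Vert=\sum_k|p_k|$. Let $C^0([-r,0],\mathbb R^n)$ carry the supremum norm, and let $X^*$ denote the topological dual of a normed space $X$, with its operator norm. For $\ell\in C^0([-r,0],\mathbb R)^*$ let $\mathcal R_1(\ell)\in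 NBV([-r,0],\mathbb R)$ be the function determined by $$\langle \ell,\varphi\rangle=\int_{-r}^0 d\mathcal R_1(\ell)(\theta)\,\varphi(\theta)\qquad\text{for all }\varphi\in C^0([-r,0],\mathbb R).$$ For $L\in C^0([-r,0],\mathbb R^n)^*$ define $\ell_k\in C^0([-r,0],\mathbb R)^*$ by $\langle \ell_k,\varphi\rangle:=\langle L,\varphi e_k\rangle$ for $1\le k\le n$, and set $$\mathcal R_n(L):=\sum_{k=1}^n\mathcal R_1(\ell_k)\,e_k^*\in NBV([-r,0],\mathbb R^{n*}).$$ **Lemma 2.1.** The function $\mathcal R_1(\ell)$ exists and is unique for every $\ell\in C^0([-r,0],\mathbb R)^*$, so that $\mathcal R_n$ is well defined, and $\mathcal R_n$ is a linear topological isomorphism (a linear bijection, continuous with continuous inverse) from $C^0([-r,0],\mathbb R^n)^*$ onto $NBV([-r,0],\mathbb R^{n*})$. -/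

import Mathlib

open Set MeasureTheory

/-- Closed intervals of the ordered space `[a, b]` are compact. -/
instance iccCompactIccSpace (a b : ℝ) : CompactIccSpace (Icc a b) :=
  ⟨fun {_ _} => isClosed_Icc.isCompact⟩

theorem eVariationOn_add_le {α E : Type*} [LinearOrder α] [NormedAddCommGroup E]
    (f g : α → E) (s : Set α) :
    eVariationOn (f + g) s ≤ eVariationOn f s + eVariationOn g s := by
  refine iSup_le fun p => ?_
  calc ∑ i ∈ Finset.range p.1, edist ((f + g) (p.2.1 (i + 1))) ((f + g) (p.2.1 i))
      ≤ ∑ i ∈ Finset.range p.1, (edist (f (p.2.1 (i + 1))) (f (p.2.1 i)) +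
          edist (g (p.2.1 (i + 1))) (g (p.2.1 i))) :=
        Finset.sum_le_sum fun i _ => edist_add_add_le _ _ _ _
    _ ≤ _ := by
        rw [Finset.sum_add_distrib]
        exact add_le_add (eVariationOn.sum_le p.2.2.1 p.2.2.2)
          (eVariationOn.sum_le p.2.2.1 p.2.2.2)

theorem eVariationOn_clm_comp_le {α E F : Type*} [LinearOrder α] [NormedAddCommGroup E]
    [NormedSpace ℝ E] [NormedAddCommGroup F] [NormedSpace ℝ F]
    (A : E →L[ℝ] F) (f : α → E) (s : Set α) :
    eVariationOn (fun t => A (f t)) s ≤ (‖A‖₊ : ENNReal) * eVariationOn f s := by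
  refine iSup_le fun p => ?_
  calc ∑ i ∈ Finset.range p.1, edist (A (f (p.2.1 (i + 1)))) (A (f (p.2.1 i)))
      ≤ ∑ i ∈ Finset.range p.1, (‖A‖₊ : ENNReal) * edist (f (p.2.1 (i + 1))) (f (p.2.1 i)) :=
        Finset.sum_le_sum fun i _ => A.lipschitz _ _
    _ ≤ _ := by
        rw [← Finset.mul_sum]
        gcongr
        exact eVariationOn.sum_le p.2.2.1 p.2.2.2

theorem eVariationOn_smul {α E : Type*} [LinearOrder α] [NormedAddCommGroup E]
    [NormedSpace ℝ E] (c : ℝ) (f : α → E) (s : Set α) :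
    eVariationOn (c • f) s = (‖c‖₊ : ENNReal) * eVariationOn f s := by
  simp only [eVariationOn, ENNReal.mul_iSup, Finset.mul_sum, Pi.smul_apply, edist_smul₀,
    ENNReal.smul_def, smul_eq_mul]

/-- The functions `g : [a, b] → E` of bounded variation that are left-continuous on `[a, b)` and
satisfy `g a = 0`, as a linear subspace of all functions. -/
def nbvSubmodule (a b : ℝ) (E : Type*) [NormedAddCommGroup E] [NormedSpace ℝ E] :
    Submodule ℝ (Icc a b → E) where
  carrier := {g | BoundedVariationOn g univ ∧
    (∀ t : Icc a b, (t : ℝ) < b → ContinuousWithinAt g (Iic t) t) ∧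
    ∀ t : Icc a b, (t : ℝ) = a → g t = 0}
  add_mem' := by
    rintro f g ⟨hf, hf', hf0⟩ ⟨hg, hg', hg0⟩
    refine ⟨?_, fun t ht => (hf' t ht).add (hg' t ht), fun t ht => ?_⟩
    · exact ne_top_of_le_ne_top (ENNReal.add_ne_top.2 ⟨hf, hg⟩) (eVariationOn_add_le f g univ)
    · simp [hf0 t ht, hg0 t ht]
  zero_mem' := by
    refine ⟨?_, fun t _ => continuousWithinAt_const, fun t _ => rfl⟩
    have h : eVariationOn (0 : Icc a b → E) univ = 0 :=
      eVariationOn.constant_on (by rintro _ ⟨x, -, rfl⟩ _ ⟨y, -, rfl⟩; rfl)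
    simp [BoundedVariationOn, h]
  smul_mem' := by
    rintro c f ⟨hf, hf', hf0⟩
    refine ⟨?_, fun t ht => (hf' t ht).const_smul c, fun t ht => ?_⟩
    · rw [BoundedVariationOn, eVariationOn_smul]
      exact ENNReal.mul_ne_top ENNReal.coe_ne_top hf
    · simp [hf0 t ht]

/-- The space `NBV([a, b], E)`. It is kept apart from the subspace above so that it carries the
topology of its own norm and not that of pointwise convergence. -/
def NBV (a b : ℝ) (E : Type*) [NormedAddCommGroup E] [NormedSpace ℝ E] : Type _ :=
  ↥(nbvSubmodule a b E)

namespace NBV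

variable {a b : ℝ} {E : Type*} [NormedAddCommGroup E] [NormedSpace ℝ E]

noncomputable instance : AddCommGroup (NBV a b E) :=
  inferInstanceAs (AddCommGroup ↥(nbvSubmodule a b E))

noncomputable instance : Module ℝ (NBV a b E) :=
  inferInstanceAs (Module ℝ ↥(nbvSubmodule a b E))

instance : CoeFun (NBV a b E) (fun _ => Icc a b → E) := ⟨fun g => g.1⟩

/-- The norm on `NBV([a, b], E)` is the total variation on `[a, b]`. -/
noncomputable instance : Norm (NBV a b E) := ⟨fun g => (eVariationOn g.1 univ).toReal⟩

theorem normedCore : NormedSpace.Core ℝ (NBV a b E) where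
  norm_nonneg _ := ENNReal.toReal_nonneg
  norm_smul c g := by
    change (eVariationOn (c • g.1) univ).toReal = ‖c‖ * (eVariationOn g.1 univ).toReal
    rw [eVariationOn_smul, ENNReal.toReal_mul]
    simp
  norm_triangle f g := by
    change (eVariationOn (f.1 + g.1) univ).toReal ≤
      (eVariationOn f.1 univ).toReal + (eVariationOn g.1 univ).toReal
    rw [← ENNReal.toReal_add f.2.1 g.2.1]
    exact ENNReal.toReal_mono (ENNReal.add_ne_top.2 ⟨f.2.1, g.2.1⟩) (eVariationOn_add_le _ _ _)
  norm_eq_zero_iff g := by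
    change (eVariationOn g.1 univ).toReal = 0 ↔ g = 0
    constructor
    · intro h
      have h0 : eVariationOn g.1 univ = 0 :=
        ((ENNReal.toReal_eq_zero_iff _).1 h).resolve_right g.2.1
      refine Subtype.ext (funext fun t => ?_)
      have hab : a ≤ b := t.2.1.trans t.2.2
      have h1 := (eVariationOn.eq_zero_iff g.1).1 h0 t (mem_univ _) ⟨a, le_rfl, hab⟩ (mem_univ _)
      rw [edist_eq_zero.1 h1]
      exact g.2.2.2 _ rfl
    · rintro rfl
      have h : eVariationOn (0 : Icc a b → E) univ = 0 :=
        eVariationOn.constant_on (by rintro _ ⟨x, -, rfl⟩ _ ⟨y, -, rfl⟩; rfl)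
      exact (congrArg ENNReal.toReal h).trans rfl

noncomputable instance : NormedAddCommGroup (NBV a b E) :=
  NormedAddCommGroup.ofCore normedCore

noncomputable instance : NormedSpace ℝ (NBV a b E) :=
  NormedSpace.ofCore normedCore

/-- The function `θ ↦ γ(θ) v`, for a scalar `γ ∈ NBV([a, b], ℝ)` and a vector `v`. -/
noncomputable def smulVec (γ : NBV a b ℝ) (v : E) : NBV a b E :=
  ⟨fun t => γ t • v, by
    refine ⟨?_, fun t ht => (γ.2.2.1 t ht).smul continuousWithinAt_const, fun t ht => ?_⟩
    · exact ne_top_of_le_ne_top (ENNReal.mul_ne_top ENNReal.coe_ne_top γ.2.1)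
        (eVariationOn_clm_comp_le (ContinuousLinearMap.toSpanSingleton ℝ v) γ.1 univ)
    · simp [γ.2.2.2 t ht]⟩

/-- The Lebesgue–Stieltjes signed measure of `γ ∈ NBV([a, b], ℝ)` on the Borel sets of `[a, b]`. It
gives mass `γ(β) - γ(α)` to `[α, β)` for `a ≤ α < β < b` and `γ(b) - γ(α)` to `[α, b]`. -/
noncomputable def stieltjes (γ : NBV a b ℝ) : SignedMeasure (Icc a b) :=
  BoundedVariationOn.vectorMeasure γ.2.1

/-- The Lebesgue–Stieltjes integral `∫_a^b dγ(θ) φ(θ)`, over the closed interval `[a, b]`. -/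
noncomputable def integral (γ : NBV a b ℝ) (φ : Icc a b → ℝ) : ℝ :=
  ∫ᵛ t, φ t ∂•γ.stieltjes

end NBV

/-- `g` represents the functional `ℓ` on `C⁰([a, b], ℝ)`: `ℓ(φ) = ∫_a^b dg(θ) φ(θ)` for all `φ`. -/
def RieszRepresents {a b : ℝ} (ℓ : StrongDual ℝ C(Icc a b, ℝ)) (g : NBV a b ℝ) : Prop :=
  ∀ φ : C(Icc a b, ℝ), ℓ φ = g.integral φ

/-- The operator `R₁ : C⁰([a, b], ℝ)* → NBV([a, b], ℝ)`: `R₁ ℓ` is the function that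
represents `ℓ`. -/
noncomputable def riesz₁ {a b : ℝ} (ℓ : StrongDual ℝ C(Icc a b, ℝ)) : NBV a b ℝ :=
  Classical.epsilon fun g => RieszRepresents ℓ g

/-- The `k`-th component `ℓ_k(φ) = L(φ e_k)` of a functional `L` on `C⁰([a, b], ℝⁿ)`. -/
noncomputable def dualComponent {a b : ℝ} {n : ℕ} (L : StrongDual ℝ C(Icc a b, Fin n → ℝ))
    (k : Fin n) : StrongDual ℝ C(Icc a b, ℝ) :=
  L.comp ((ContinuousLinearMap.toSpanSingleton ℝ
    (Pi.single k 1 : Fin n → ℝ)).compLeftContinuous ℝ (Icc a b))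

/-- The operator `Rₙ : C⁰([a, b], ℝⁿ)* → NBV([a, b], ℝⁿ*)`, `Rₙ L = ∑ k, R₁(ℓ_k) e_k*`, where
`e_k*` is the `k`-th coordinate form. Here `ℝⁿ = Fin n → ℝ` has the maximum norm and its dual
`ℝⁿ*` the dual norm, which is the sum of the absolute values of the coordinates. -/
noncomputable def riesz {a b : ℝ} {n : ℕ} (L : StrongDual ℝ C(Icc a b, Fin n → ℝ)) :
    NBV a b (StrongDual ℝ (Fin n → ℝ)) :=
  ∑ k, (riesz₁ (dualComponent L k)).smulVec (ContinuousLinearMap.proj k)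

/-! The scalar case is the Riesz representation theorem. For existence, extend `ℓ` by Hahn–Banach,
without increasing its norm, to a functional `Λ` on all bounded functions, and let `G t` be the
value of `Λ` at the indicator of `[a, t)` (of all of `[a, b]` if `t = b`). Step functions
approximate a continuous `φ` uniformly, and `Λ` sends them to Stieltjes sums of `G`; testing with
signs bounds the variation of `G` by `‖Λ‖`. Passing to left limits on `[a, b)` increases no
variation and keeps the limit of the sums (`tendsto_riemannSum_leftRegularization`).

The measure of `g` integrates the same indicators to the values of `g`, so its integral is the limit
of the same sums (`tendsto_riemannSum_integral`). This identifies the two sides, and also gives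
linearity in `g` and the bound by `‖g‖ * ‖φ‖`. Uniqueness holds because continuous functions
determine a finite signed measure, and the measure determines `g`.

For vectors, `vectorIntegral` integrates coordinatewise and is a two-sided inverse of `riesz`; both
are bounded, with explicit constants. -/

namespace NBV

open Filter Topology

variable {a b : ℝ}

/-! ### Indicators of initial segments and step functions -/

/-- The half-open interval `[a, t)` if `t < b`, and all of `[a, b]` if `t = b`. -/
def lowerPart (t : Icc a b) : Set (Icc a b) := {x | x < t ∨ (t : ℝ) = b}

theorem lowerPart_mono : Monotone (lowerPart (a := a) (b := b)) := by
  rintro s t hst x (hx | hx)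
  · exact Or.inl (hx.trans_le hst)
  · exact Or.inr (le_antisymm t.2.2 (hx.ge.trans hst))

theorem lowerPart_of_lt {t : Icc a b} (ht : (t : ℝ) < b) : lowerPart t = Iio t := by
  ext x
  simp [lowerPart, ht.ne]

theorem lowerPart_of_eq {t : Icc a b} (ht : (t : ℝ) = b) : lowerPart t = univ := by
  ext x
  simp [lowerPart, ht]

theorem measurableSet_lowerPart (t : Icc a b) : MeasurableSet (lowerPart t) := by
  rcases t.2.2.lt_or_eq with h | h
  · rw [lowerPart_of_lt h]; exact measurableSet_Iio
  · rw [lowerPart_of_eq h]; exact MeasurableSet.univ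

theorem mem_Icc_of_mem_lowerPart_diff {s t x : Icc a b} (hx : x ∈ lowerPart t \ lowerPart s) :
    x ∈ Icc s t := by
  obtain ⟨h | h, h'⟩ := hx <;> simp only [lowerPart, mem_ofPred_eq, not_or, not_lt] at h'
  · exact ⟨h'.1, h.le⟩
  · exact ⟨h'.1, Subtype.coe_le_coe.1 (x.2.2.trans h.ge)⟩

/-- The indicator function of `lowerPart t`. -/
noncomputable def step (t : Icc a b) : Icc a b → ℝ := (lowerPart t).indicator fun _ => 1

theorem step_mono (x : Icc a b) : Monotone fun t => step t x := fun _ _ h =>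
  indicator_le_indicator_of_subset (lowerPart_mono h) (fun _ => zero_le_one) x

theorem step_nonneg (t x : Icc a b) : 0 ≤ step t x := indicator_nonneg (fun _ _ => zero_le_one) x

theorem step_le_one (t x : Icc a b) : step t x ≤ 1 :=
  indicator_le_self' (s := lowerPart t) (f := fun _ => (1 : ℝ)) (fun _ _ => zero_le_one) x

theorem step_of_eq_left (hab : a < b) {t : Icc a b} (ht : (t : ℝ) = a) : step t = 0 := by
  ext x
  rw [step, lowerPart_of_lt (ht.trans_lt hab), indicator_of_notMem]
  · rfl
  · exact not_lt.2 (Subtype.coe_le_coe.1 (ht.le.trans x.2.1))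

theorem step_of_eq_right {t : Icc a b} (ht : (t : ℝ) = b) : step t = 1 := by
  ext x
  simp [step, lowerPart_of_eq ht]

/-- At fixed `x` the increments of `step` are nonnegative and telescope to at most 1. -/
theorem abs_sum_mul_step_sub_le_one {u : ℕ → Icc a b} (hu : Monotone u) {c : ℕ → ℝ}
    (hc : ∀ i, |c i| ≤ 1) (N : ℕ) (x : Icc a b) :
    |∑ i ∈ Finset.range N, c i * (step (u (i + 1)) x - step (u i) x)| ≤ 1 := by
  have hd : ∀ i, 0 ≤ step (u (i + 1)) x - step (u i) x := fun i =>
    sub_nonneg.2 (step_mono x (hu i.le_succ))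
  calc _ ≤ ∑ i ∈ Finset.range N, |c i * (step (u (i + 1)) x - step (u i) x)| :=
        Finset.abs_sum_le_sum_abs _ _
    _ ≤ ∑ i ∈ Finset.range N, (step (u (i + 1)) x - step (u i) x) := by
        refine Finset.sum_le_sum fun i _ => ?_
        rw [abs_mul, abs_of_nonneg (hd i)]
        exact mul_le_of_le_one_left (hd i) (hc i)
    _ = step (u N) x - step (u 0) x := Finset.sum_range_sub (fun i => step (u i) x) N
    _ ≤ 1 := by linarith [step_le_one (u N) x, step_nonneg (u 0) x]

/-- The increments are nonnegative weights of sum 1, and a nonzero weight forces `x` to lie between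
`u i` and `u (i + 1)`. The values `c i` are arbitrary, so tags may later lie outside their
subintervals. -/
theorem abs_sub_sum_mul_step_sub_le (hab : a < b) {u : ℕ → Icc a b} (hu : Monotone u) {N : ℕ}
    (h0 : (u 0 : ℝ) = a) (hN : (u N : ℝ) = b) {c : ℕ → ℝ} {x : Icc a b} {v ε : ℝ}
    (h : ∀ i, x ∈ Icc (u i) (u (i + 1)) → |v - c i| ≤ ε) :
    |v - ∑ i ∈ Finset.range N, c i * (step (u (i + 1)) x - step (u i) x)| ≤ ε := by
  have hd : ∀ i, 0 ≤ step (u (i + 1)) x - step (u i) x := fun i =>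
    sub_nonneg.2 (step_mono x (hu i.le_succ))
  have hsum : ∑ i ∈ Finset.range N, (step (u (i + 1)) x - step (u i) x) = 1 := by
    rw [Finset.sum_range_sub (fun i => step (u i) x), step_of_eq_left hab h0, step_of_eq_right hN]
    simp
  calc _ = |∑ i ∈ Finset.range N, (v - c i) * (step (u (i + 1)) x - step (u i) x)| := by
        simp only [sub_mul, Finset.sum_sub_distrib, ← Finset.mul_sum, hsum, mul_one]
    _ ≤ ∑ i ∈ Finset.range N, |(v - c i) * (step (u (i + 1)) x - step (u i) x)| :=
        Finset.abs_sum_le_sum_abs _ _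
    _ ≤ ∑ i ∈ Finset.range N, ε * (step (u (i + 1)) x - step (u i) x) := by
        refine Finset.sum_le_sum fun i _ => ?_
        rw [abs_mul, abs_of_nonneg (hd i)]
        by_cases hx : x ∈ lowerPart (u (i + 1)) \ lowerPart (u i)
        · exact mul_le_mul_of_nonneg_right (h i (mem_Icc_of_mem_lowerPart_diff hx)) (hd i)
        · have h0 : step (u (i + 1)) x - step (u i) x = 0 := by
            by_cases h1 : x ∈ lowerPart (u i)
            · simp [step, h1, lowerPart_mono (hu i.le_succ) h1]
            · have h2 : x ∉ lowerPart (u (i + 1)) := fun h2 => hx ⟨h2, h1⟩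
              simp [step, h1, h2]
          simp [h0]
    _ = ε := by rw [← Finset.mul_sum, hsum, mul_one]

/-! ### Equidistant Riemann–Stieltjes sums -/

/-- The `i`-th point of the division of `[a, b]` into `N` equal parts. -/
noncomputable def node (hab : a < b) (N i : ℕ) : Icc a b :=
  projIcc a b hab.le (a + i * ((b - a) / N))

theorem node_mono (hab : a < b) (N : ℕ) : Monotone (node hab N) := fun i j hij =>
  monotone_projIcc hab.le (by
    have : 0 ≤ (b - a) / N := div_nonneg (sub_nonneg.2 hab.le) N.cast_nonneg
    gcongr)

theorem node_zero (hab : a < b) (N : ℕ) : (node hab N 0 : ℝ) = a := by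
  simp [node]

theorem node_self (hab : a < b) {N : ℕ} (hN : N ≠ 0) : (node hab N N : ℝ) = b := by
  have : a + (N : ℝ) * ((b - a) / N) = b := by field_simp; ring
  rw [node, this, projIcc_right]

theorem node_succ_sub_le (hab : a < b) (N i : ℕ) :
    (node hab N (i + 1) : ℝ) - node hab N i ≤ (b - a) / N := by
  have : 0 ≤ (b - a) / N := div_nonneg (sub_nonneg.2 hab.le) N.cast_nonneg
  have h := abs_projIcc_sub_projIcc (c := a + ((i + 1 : ℕ) : ℝ) * ((b - a) / N))
    (d := a + i * ((b - a) / N)) hab.le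
  refine (le_abs_self _).trans (h.trans ?_)
  rw [show a + ((i + 1 : ℕ) : ℝ) * ((b - a) / N) - (a + i * ((b - a) / N)) = (b - a) / N by
    push_cast; ring, abs_of_nonneg this]

/-- The Riemann–Stieltjes sum of `φ` with respect to `g` on the division into `N` equal parts. -/
noncomputable def riemannSum (hab : a < b) (g φ : Icc a b → ℝ) (N : ℕ) : ℝ :=
  ∑ i ∈ Finset.range N, φ (node hab N i) * (g (node hab N (i + 1)) - g (node hab N i))

theorem exists_forall_abs_sub_le (φ : C(Icc a b, ℝ)) {ε : ℝ} (hε : 0 < ε) :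
    ∃ δ > 0, ∀ x y : Icc a b, |(x : ℝ) - y| < δ → |φ x - φ y| ≤ ε := by
  obtain ⟨δ, hδ, h⟩ := Metric.uniformContinuous_iff.1
    (CompactSpace.uniformContinuous_of_continuous φ.continuous) ε hε
  exact ⟨δ, hδ, fun x y hxy => (h (a := x) (b := y) hxy).le⟩

theorem eventually_div_lt (c : ℝ) {δ : ℝ} (hδ : 0 < δ) : ∀ᶠ N : ℕ in atTop, c / N < δ :=
  (tendsto_const_div_atTop_nhds_zero_nat c).eventually_lt_const hδ

theorem tendsto_of_forall_eventually_abs_sub_le {S : ℕ → ℝ} {L M : ℝ}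
    (h : ∀ ε > 0, ∀ᶠ N in atTop, |L - S N| ≤ M * ε) : Tendsto S atTop (𝓝 L) := by
  rw [Metric.tendsto_nhds]
  intro ε hε
  -- `M` may be zero or negative, hence `|M| + 1` as divisor.
  have hM : 0 < |M| + 1 := by positivity
  filter_upwards [h (ε / (2 * (|M| + 1))) (by positivity)] with N hN
  rw [dist_comm, Real.dist_eq]
  refine hN.trans_lt ?_
  calc M * (ε / (2 * (|M| + 1))) ≤ (|M| + 1) * (ε / (2 * (|M| + 1))) := by
        gcongr; linarith [le_abs_self M]
    _ = ε / 2 := by field_simp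
    _ < ε := by linarith

/-! ### The Stieltjes integral as a limit of Riemann–Stieltjes sums -/

/-- The mass of `[a, t)` is the left limit at `t`, which is `g t` by left-continuity. At `b` the
total mass is `g b` itself, so no continuity is needed there. -/
theorem stieltjes_lowerPart (hab : a < b) (g : NBV a b ℝ) (t : Icc a b) :
    g.stieltjes (lowerPart t) = g t := by
  have : Nonempty (Icc a b) := ⟨t⟩
  have hbot : limUnder atBot g.1 = 0 := by
    refine Tendsto.limUnder_eq (tendsto_const_nhds.congr'
      ((eventually_le_atBot ⟨a, le_rfl, hab.le⟩).mono fun x hx => ?_))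
    exact (g.2.2.2 x (le_antisymm hx x.2.1)).symm
  rcases t.2.2.lt_or_eq with h | h
  · rw [lowerPart_of_lt h, stieltjes, BoundedVariationOn.vectorMeasure_Iio, hbot, sub_zero]
    exact (g.2.2.1 t h).leftLim_eq
  · rw [lowerPart_of_eq h, stieltjes, BoundedVariationOn.vectorMeasure_univ, hbot, sub_zero]
    -- The order has the greatest element `b`, so the limit along `atTop` is the value there.
    refine Tendsto.limUnder_eq (tendsto_const_nhds.congr'
      ((eventually_ge_atTop t).mono fun x hx => ?_))
    rw [le_antisymm hx (Subtype.coe_le_coe.1 (x.2.2.trans h.ge))]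

instance isFiniteMeasure_variation_stieltjes (g : NBV a b ℝ) :
    IsFiniteMeasure g.stieltjes.variation := by
  rw [← SignedMeasure.totalVariation_eq_variation]
  infer_instance

theorem integrable_continuousMap (g : NBV a b ℝ) (φ : C(Icc a b, ℝ)) :
    g.stieltjes.Integrable φ :=
  φ.continuous.integrable_of_hasCompactSupport (HasCompactSupport.of_compactSpace φ)

theorem integrable_step (g : NBV a b ℝ) (t : Icc a b) : g.stieltjes.Integrable (step t) :=
  (integrable_const (1 : ℝ)).indicator (measurableSet_lowerPart t)

theorem integral_step (hab : a < b) (g : NBV a b ℝ) (t : Icc a b) :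
    ∫ᵛ x, step t x ∂•g.stieltjes = g t := by
  simp only [step]
  rw [VectorMeasure.integral_indicator_const _ (measurableSet_lowerPart t),
    stieltjes_lowerPart hab]
  simp

theorem integral_sum_step (hab : a < b) (g : NBV a b ℝ) (u : ℕ → Icc a b) (c : ℕ → ℝ) (N : ℕ) :
    ∫ᵛ x, ∑ i ∈ Finset.range N, c i * (step (u (i + 1)) x - step (u i) x) ∂•g.stieltjes =
      ∑ i ∈ Finset.range N, c i * (g (u (i + 1)) - g (u i)) := by
  rw [VectorMeasure.integral_finsetSum]
  · refine Finset.sum_congr rfl fun i _ => ?_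
    simp only [← smul_eq_mul (c i)]
    rw [VectorMeasure.integral_fun_smul, VectorMeasure.integral_fun_sub (integrable_step g _)
      (integrable_step g _), integral_step hab, integral_step hab]
  · intro i _
    exact ((integrable_step g _).sub (integrable_step g _)).const_mul (c i)

/-- The `N`-th sum is the integral of a step function uniformly close to `φ`, and the measure has
finite total variation. -/
theorem tendsto_riemannSum_integral (hab : a < b) (g : NBV a b ℝ) (φ : C(Icc a b, ℝ)) :
    Tendsto (riemannSum hab g φ) atTop (𝓝 (g.integral φ)) := by
  refine tendsto_of_forall_eventually_abs_sub_le
    (M := ‖ContinuousLinearMap.lsmul ℝ ℝ (E := ℝ)‖ * g.stieltjes.variation.real univ)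
    fun ε hε => ?_
  obtain ⟨δ, hδ, h⟩ := exists_forall_abs_sub_le φ hε
  filter_upwards [eventually_div_lt (b - a) hδ, eventually_ne_atTop 0] with N hN hN0
  rw [riemannSum, ← integral_sum_step hab g (node hab N) (fun i => φ (node hab N i)), integral,
    ← VectorMeasure.integral_fun_sub (integrable_continuousMap g φ)]
  · rw [← Real.norm_eq_abs, mul_comm, ← mul_assoc]
    refine VectorMeasure.norm_integral_le_of_norm_le_const (Eventually.of_forall fun x => ?_)
    refine abs_sub_sum_mul_step_sub_le hab (node_mono hab N) (node_zero hab N)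
      (node_self hab hN0) fun i hx => h _ _ ?_
    have h1 : (node hab N i : ℝ) ≤ x := hx.1
    have h2 : (x : ℝ) ≤ node hab N (i + 1) := hx.2
    rw [abs_of_nonneg (sub_nonneg.2 h1)]
    linarith [node_succ_sub_le hab N i]
  · exact integrable_finsetSum _ fun i _ =>
      ((integrable_step g _).sub (integrable_step g _)).const_mul _

theorem sum_abs_sub_le {f : Icc a b → ℝ} (hf : BoundedVariationOn f univ) {u : ℕ → Icc a b}
    (hu : Monotone u) (N : ℕ) :
    ∑ i ∈ Finset.range N, |f (u (i + 1)) - f (u i)| ≤ (eVariationOn f univ).toReal := by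
  rw [← ENNReal.ofReal_le_iff_le_toReal hf, ENNReal.ofReal_sum_of_nonneg fun _ _ => abs_nonneg _]
  simpa only [edist_dist, Real.dist_eq] using
    eVariationOn.sum_le (f := f) (s := univ) (n := N) hu fun _ => mem_univ _

/-- The bound holds for every Stieltjes sum, so the variation of the measure need not be compared
with that of `g`. -/
theorem abs_integral_le (hab : a < b) (g : NBV a b ℝ) (φ : C(Icc a b, ℝ)) :
    |g.integral φ| ≤ ‖g‖ * ‖φ‖ := by
  refine le_of_tendsto (tendsto_riemannSum_integral hab g φ).abs (Eventually.of_forall fun N => ?_)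
  calc |riemannSum hab g φ N|
      ≤ ∑ i ∈ Finset.range N, |φ (node hab N i) * (g (node hab N (i + 1)) - g (node hab N i))| :=
        Finset.abs_sum_le_sum_abs _ _
    _ ≤ ∑ i ∈ Finset.range N, ‖φ‖ * |g (node hab N (i + 1)) - g (node hab N i)| := by
        refine Finset.sum_le_sum fun i _ => ?_
        rw [abs_mul]
        exact mul_le_mul_of_nonneg_right (φ.norm_coe_le_norm _) (abs_nonneg _)
    _ ≤ ‖φ‖ * ‖g‖ := by
        rw [← Finset.mul_sum]
        exact mul_le_mul_of_nonneg_left (sum_abs_sub_le g.2.1 (node_mono hab N) N) (norm_nonneg _)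
    _ = ‖g‖ * ‖φ‖ := mul_comm _ _

/-- Stieltjes sums are visibly additive in the integrator; additivity of `stieltjes` is not needed.
-/
theorem integral_add_left (hab : a < b) (f g : NBV a b ℝ) (φ : C(Icc a b, ℝ)) :
    (f + g).integral φ = f.integral φ + g.integral φ := by
  refine tendsto_nhds_unique (tendsto_riemannSum_integral hab (f + g) φ)
    (((tendsto_riemannSum_integral hab f φ).add (tendsto_riemannSum_integral hab g φ)).congr
      fun N => ?_)
  simp only [riemannSum, ← Finset.sum_add_distrib]
  refine Finset.sum_congr rfl fun i _ => ?_
  change _ = _ * ((f.1 _ + g.1 _) - (f.1 _ + g.1 _))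
  ring

theorem integral_smul_left (hab : a < b) (c : ℝ) (g : NBV a b ℝ) (φ : C(Icc a b, ℝ)) :
    (c • g).integral φ = c * g.integral φ := by
  refine tendsto_nhds_unique (tendsto_riemannSum_integral hab (c • g) φ)
    (((tendsto_riemannSum_integral hab g φ).const_mul c).congr fun N => ?_)
  simp only [riemannSum, Finset.mul_sum]
  refine Finset.sum_congr rfl fun i _ => ?_
  change _ = _ * (c • g.1 _ - c • g.1 _)
  simp only [smul_eq_mul]
  ring

theorem integral_add (g : NBV a b ℝ) (φ ψ : C(Icc a b, ℝ)) :
    g.integral (φ + ψ) = g.integral φ + g.integral ψ :=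
  VectorMeasure.integral_add (integrable_continuousMap g φ) (integrable_continuousMap g ψ)

theorem integral_smul (g : NBV a b ℝ) (c : ℝ) (φ : C(Icc a b, ℝ)) :
    g.integral (c • φ) = c * g.integral φ :=
  VectorMeasure.integral_smul _ _ (f := φ) c

/-- The functional `φ ↦ ∫_a^b dg(θ) φ(θ)` on `C⁰([a, b], ℝ)`. -/
noncomputable def integralCLM (hab : a < b) (g : NBV a b ℝ) : StrongDual ℝ C(Icc a b, ℝ) :=
  LinearMap.mkContinuous
    { toFun := fun φ => g.integral φ
      map_add' := integral_add g
      map_smul' := integral_smul g } ‖g‖ (abs_integral_le hab g)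

theorem ext_of_forall_integral_eq (hab : a < b) {f g : NBV a b ℝ}
    (h : ∀ φ : C(Icc a b, ℝ), f.integral φ = g.integral φ) : f = g := by
  have key : ∀ d : NBV a b ℝ, (∀ φ : C(Icc a b, ℝ), d.integral φ = 0) → d = 0 := by
    intro d hd
    set j := d.stieltjes.toJordanDecomposition
    have hdj : d.stieltjes = j.posPart.toSignedMeasure - j.negPart.toSignedMeasure :=
      d.stieltjes.toSignedMeasure_toJordanDecomposition.symm
    -- Real multiplication commutes; the flipped pairing is used below to reach ordinary integrals.
    have hflip : ContinuousLinearMap.lsmul ℝ ℝ =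
        (ContinuousLinearMap.lsmul ℝ ℝ (E := ℝ)).flip := by
      ext
      simp
    -- Finite measures with equal integrals of all continuous functions coincide, so the two Jordan
    -- parts cancel.
    have hpn : j.posPart = j.negPart := by
      refine ext_of_forall_integral_eq_of_IsFiniteMeasure fun φ => sub_eq_zero.1 ?_
      have hint : ∀ (μ : Measure (Icc a b)) [IsFiniteMeasure μ],
          μ.toSignedMeasure.Integrable φ := by
        intro μ _
        rw [VectorMeasure.Integrable, Measure.variation_toSignedMeasure]
        exact φ.integrable μ
      have : ∫ᵛ x, φ x ∂•d.stieltjes = 0 := hd φ.toContinuousMap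
      rwa [hdj, hflip, VectorMeasure.integral_sub_vectorMeasure (hint _) (hint _),
        VectorMeasure.integral_toSignedMeasure, VectorMeasure.integral_toSignedMeasure] at this
    refine Subtype.ext (funext fun t => ?_)
    rw [← stieltjes_lowerPart hab d t, hdj]
    simp only [hpn, sub_self]
    rfl
  refine sub_eq_zero.1 (key _ fun φ => ?_)
  rw [sub_eq_add_neg, ← neg_one_smul ℝ g, integral_add_left hab, integral_smul_left hab, h]
  ring

/-! ### Left-continuous modification of a function of bounded variation -/

/-- Shift to the left by `s`, cut off at `a`, with `b` as a fixed point. -/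
noncomputable def backShift (s : ℝ) (t : Icc a b) : Icc a b :=
  if (t : ℝ) = b then t else projIcc a b (t.2.1.trans t.2.2) (t - |s|)

theorem backShift_le (s : ℝ) (t : Icc a b) : backShift s t ≤ t := by
  unfold backShift
  split_ifs with h
  · exact le_rfl
  · refine Subtype.coe_le_coe.1 ?_
    rw [coe_projIcc]
    exact max_le t.2.1 ((min_le_right _ _).trans (sub_le_self _ (abs_nonneg s)))

theorem sub_abs_le_backShift (s : ℝ) (t : Icc a b) : (t : ℝ) - |s| ≤ backShift s t := by
  unfold backShift
  split_ifs with h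
  · exact sub_le_self _ (abs_nonneg s)
  · rw [coe_projIcc]
    exact le_max_of_le_right (le_min ((sub_le_self _ (abs_nonneg s)).trans t.2.2) le_rfl)

theorem backShift_mono (s : ℝ) : Monotone (backShift (a := a) (b := b) s) := by
  intro t u htu
  by_cases hu : (u : ℝ) = b
  · refine Subtype.coe_le_coe.1 ?_
    rw [show backShift s u = u from if_pos hu, hu]
    exact (backShift s t).2.2
  · have ht : (t : ℝ) ≠ b := fun ht => hu (le_antisymm u.2.2 (ht.ge.trans htu))
    simp only [backShift, if_neg hu, if_neg ht]
    exact monotone_projIcc _ (sub_le_sub_right (Subtype.coe_le_coe.2 htu) _)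

theorem backShift_of_eq_left {t : Icc a b} (ht : (t : ℝ) = a) (s : ℝ) : backShift s t = t :=
  le_antisymm (backShift_le s t) (Subtype.coe_le_coe.1 (ht.le.trans (backShift s t).2.1))

theorem backShift_of_eq_right {t : Icc a b} (ht : (t : ℝ) = b) (s : ℝ) : backShift s t = t :=
  if_pos ht

theorem backShift_lt {t : Icc a b} (hta : a < t) (htb : (t : ℝ) < b) {s : ℝ} (hs : 0 < s) :
    backShift s t < t := by
  refine Subtype.coe_lt_coe.1 ?_
  rw [backShift, if_neg htb.ne, coe_projIcc]
  exact max_lt hta ((min_le_right _ _).trans_lt (sub_lt_self _ (abs_pos.2 hs.ne')))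

/-- The left-limit function of `G`, keeping the value at the right endpoint `b`. -/
noncomputable def leftRegularization (G : Icc a b → ℝ) (t : Icc a b) : ℝ :=
  if (t : ℝ) = b then G t else G.leftLim t

/-- Interior points are approached strictly from the left. Both endpoints are fixed by the shift,
and at the least element the left limit is by convention the value. -/
theorem tendsto_comp_backShift {G : Icc a b → ℝ} (hG : BoundedVariationOn G univ) (t : Icc a b) :
    Tendsto (fun s => G (backShift s t)) (𝓝[>] 0) (𝓝 (leftRegularization G t)) := by
  rcases t.2.2.lt_or_eq with htb | htb
  · rw [leftRegularization, if_neg htb.ne]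
    rcases t.2.1.lt_or_eq with hta | hta
    · refine (hG.tendsto_leftLim t).comp (tendsto_nhdsWithin_iff.2 ⟨?_, ?_⟩)
      · rw [tendsto_subtype_rng]
        have h1 : Tendsto (fun s : ℝ => (t : ℝ) - |s|) (𝓝[>] 0) (𝓝 (t : ℝ)) := by
          have : Tendsto (fun s : ℝ => (t : ℝ) - |s|) (𝓝 0) (𝓝 ((t : ℝ) - |0|)) :=
            (continuous_const.sub continuous_abs).tendsto 0
          simpa using this.mono_left nhdsWithin_le_nhds
        exact tendsto_of_tendsto_of_tendsto_of_le_of_le h1 tendsto_const_nhds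
          (fun s => sub_abs_le_backShift s t) (fun s => backShift_le s t)
      · filter_upwards [self_mem_nhdsWithin] with s hs using backShift_lt hta htb hs
    · have hbot : IsBot t := fun x => Subtype.coe_le_coe.1 (hta.ge.trans x.2.1)
      simp only [backShift_of_eq_left hta.symm, leftLim_eq_of_isBot hbot]
      exact tendsto_const_nhds
  · simp only [leftRegularization, if_pos htb, backShift_of_eq_right htb]
    exact tendsto_const_nhds

/-- Variation is lower semicontinuous under pointwise limits, and composing with the monotone
`backShift s` does not increase it. -/
theorem eVariationOn_leftRegularization_le {G : Icc a b → ℝ} (hG : BoundedVariationOn G univ) :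
    eVariationOn (leftRegularization G) univ ≤ eVariationOn G univ := by
  refine le_of_forall_lt fun v hv => ?_
  obtain ⟨s, hs⟩ := (eVariationOn.lowerSemicontinuous_aux
    (fun t _ => tendsto_comp_backShift hG t) hv).exists
  exact hs.trans_le (eVariationOn.comp_le_of_monotoneOn G (backShift s)
    ((backShift_mono s).monotoneOn _) (mapsTo_univ _ _))

/-- The left-continuous modification of a function of bounded variation vanishing at `a`, as an
element of `NBV`. -/
noncomputable def ofBoundedVariation (hab : a < b) (G : Icc a b → ℝ)
    (hG : BoundedVariationOn G univ) (h0 : ∀ t : Icc a b, (t : ℝ) = a → G t = 0) : NBV a b ℝ :=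
  ⟨leftRegularization G, by
    refine ⟨ne_top_of_le_ne_top hG (eVariationOn_leftRegularization_le hG), fun t ht => ?_,
      fun t ht => ?_⟩
    · refine hG.continuousWithinAt_leftLim.congr (fun x hx => ?_) ?_
      · exact if_neg ((Subtype.coe_le_coe.2 hx).trans_lt ht).ne
      · exact if_neg ht.ne
    · have hbot : IsBot t := fun x => Subtype.coe_le_coe.1 (ht.le.trans x.2.1)
      rw [leftRegularization, if_neg (ht.trans_lt hab).ne, leftLim_eq_of_isBot hbot, h0 t ht]⟩

theorem norm_ofBoundedVariation_le (hab : a < b) (G : Icc a b → ℝ)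
    (hG : BoundedVariationOn G univ) (h0 : ∀ t : Icc a b, (t : ℝ) = a → G t = 0) :
    ‖ofBoundedVariation hab G hG h0‖ ≤ (eVariationOn G univ).toReal :=
  ENNReal.toReal_mono hG (eVariationOn_leftRegularization_le hG)

/-! ### Existence of the representing function -/

/-- A continuous function as a bounded function. -/
noncomputable def toBounded : C(Icc a b, ℝ) →ₗᵢ[ℝ] lp (fun _ : Icc a b => ℝ) ⊤ where
  toFun φ := ⟨fun x => φ x, memℓp_infty ⟨‖φ‖, by rintro _ ⟨x, rfl⟩; exact φ.norm_coe_le_norm x⟩⟩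
  map_add' _ _ := rfl
  map_smul' _ _ := rfl
  norm_map' φ := by
    set f : lp (fun _ : Icc a b => ℝ) ⊤ := ⟨fun x => φ x, _⟩
    refine le_antisymm (lp.norm_le_of_forall_le (norm_nonneg φ) φ.norm_coe_le_norm) ?_
    exact (ContinuousMap.norm_le _ (norm_nonneg _)).2 fun x =>
      lp.norm_apply_le_norm ENNReal.top_ne_zero f x

/-- The function `step t` as a bounded function. -/
noncomputable def boundedStep (t : Icc a b) : lp (fun _ : Icc a b => ℝ) ⊤ :=
  ⟨step t, memℓp_infty ⟨1, by
    rintro _ ⟨x, rfl⟩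
    exact (Real.norm_of_nonneg (step_nonneg t x)).trans_le (step_le_one t x)⟩⟩

/-- Hahn–Banach on the isometric image of the continuous functions; the larger space contains the
discontinuous steps. -/
theorem exists_extension_bounded (ℓ : StrongDual ℝ C(Icc a b, ℝ)) :
    ∃ Λ : StrongDual ℝ (lp (fun _ : Icc a b => ℝ) ⊤),
      (∀ φ, Λ (toBounded φ) = ℓ φ) ∧ ‖Λ‖ ≤ ‖ℓ‖ := by
  let e := (toBounded (a := a) (b := b)).equivRange
  obtain ⟨Λ, h1, h2⟩ := exists_extension_norm_eq (toBounded (a := a) (b := b)).range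
    (ℓ.comp (e.symm.toContinuousLinearEquiv : _ →L[ℝ] C(Icc a b, ℝ)))
  refine ⟨Λ, fun φ => ?_, h2.trans_le ?_⟩
  · have := h1 (e φ)
    simpa [e] using this
  · refine ContinuousLinearMap.opNorm_le_bound _ (norm_nonneg ℓ) fun x => ?_
    exact (ℓ.le_opNorm _).trans_eq (by simp)

theorem coe_sum_boundedStep (u : ℕ → Icc a b) (c : ℕ → ℝ) (N : ℕ) (x : Icc a b) :
    (∑ i ∈ Finset.range N, c i • (boundedStep (u (i + 1)) - boundedStep (u i)) :
      lp (fun _ : Icc a b => ℝ) ⊤) x =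
    ∑ i ∈ Finset.range N, c i * (step (u (i + 1)) x - step (u i) x) := by
  rw [lp.coeFn_sum, Finset.sum_apply]
  rfl

section Extension

variable {Λ : StrongDual ℝ (lp (fun _ : Icc a b => ℝ) ⊤)}

theorem eVariationOn_boundedStep_le :
    eVariationOn (fun t => Λ (boundedStep t)) univ ≤ ENNReal.ofReal ‖Λ‖ := by
  refine iSup_le fun ⟨N, u, hu, _⟩ => ?_
  simp only [edist_dist, Real.dist_eq]
  rw [← ENNReal.ofReal_sum_of_nonneg fun _ _ => abs_nonneg _]
  refine ENNReal.ofReal_le_ofReal ?_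
  -- With these signs the variation sum becomes one value of `Λ`, at a function of norm at most 1.
  set c : ℕ → ℝ := fun i => SignType.sign (Λ (boundedStep (u (i + 1))) - Λ (boundedStep (u i)))
  calc _ = Λ (∑ i ∈ Finset.range N, c i • (boundedStep (u (i + 1)) - boundedStep (u i))) := by
        simp only [map_sum, map_smul, map_sub, smul_eq_mul, c, sign_mul_self]
    _ ≤ ‖Λ‖ * ‖∑ i ∈ Finset.range N, c i • (boundedStep (u (i + 1)) - boundedStep (u i))‖ :=
        (le_abs_self _).trans (Λ.le_opNorm _)
    _ ≤ ‖Λ‖ * 1 := by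
        gcongr
        refine lp.norm_le_of_forall_le zero_le_one fun x => ?_
        rw [coe_sum_boundedStep]
        refine abs_sum_mul_step_sub_le_one hu (fun i => ?_) N x
        rcases lt_trichotomy (Λ (boundedStep (u (i + 1))) - Λ (boundedStep (u i))) 0 with h | h | h
          <;> simp [c, h]
    _ = ‖Λ‖ := mul_one _

theorem boundedVariationOn_boundedStep :
    BoundedVariationOn (fun t => Λ (boundedStep t)) univ :=
  ne_top_of_le_ne_top ENNReal.ofReal_ne_top eVariationOn_boundedStep_le

theorem boundedStep_of_eq_left (hab : a < b) {t : Icc a b} (ht : (t : ℝ) = a) :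
    boundedStep t = 0 :=
  Subtype.ext (step_of_eq_left hab ht)

/-- For fixed `N`, the sum is the limit as `s → 0+` of sums of the unregularized function over
shifted nodes. Each of these is `Λ` at a step function within `ε` of `φ`, uniformly in small `s`. -/
theorem tendsto_riemannSum_leftRegularization (hab : a < b) (φ : C(Icc a b, ℝ)) :
    Tendsto (riemannSum hab (leftRegularization fun t => Λ (boundedStep t)) φ) atTop
      (𝓝 (Λ (toBounded φ))) := by
  refine tendsto_of_forall_eventually_abs_sub_le (M := ‖Λ‖) fun ε hε => ?_
  obtain ⟨δ, hδ, h⟩ := exists_forall_abs_sub_le φ hε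
  filter_upwards [eventually_div_lt (b - a) (half_pos hδ), eventually_ne_atTop 0] with N hN hN0
  have hG := boundedVariationOn_boundedStep (Λ := Λ)
  have hlim : Tendsto (fun s : ℝ => ∑ i ∈ Finset.range N, φ (node hab N i) *
      (Λ (boundedStep (backShift s (node hab N (i + 1)))) -
        Λ (boundedStep (backShift s (node hab N i))))) (𝓝[>] 0)
      (𝓝 (riemannSum hab (leftRegularization fun t => Λ (boundedStep t)) φ N)) :=
    tendsto_finsetSum _ fun i _ => ((tendsto_comp_backShift hG _).sub
      (tendsto_comp_backShift hG _)).const_mul _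
  refine le_of_tendsto (tendsto_const_nhds.sub hlim).abs ?_
  filter_upwards [Ioo_mem_nhdsGT (half_pos hδ)] with s hs
  set u : ℕ → Icc a b := fun i => backShift s (node hab N i) with hu
  calc _ = |Λ (toBounded φ - ∑ i ∈ Finset.range N,
        φ (node hab N i) • (boundedStep (u (i + 1)) - boundedStep (u i)))| := by
        simp only [map_sub, map_sum, map_smul, smul_eq_mul, hu]
    _ ≤ ‖Λ‖ * ‖toBounded φ - ∑ i ∈ Finset.range N,
        φ (node hab N i) • (boundedStep (u (i + 1)) - boundedStep (u i))‖ := Λ.le_opNorm _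
    _ ≤ ‖Λ‖ * ε := by
        gcongr
        refine lp.norm_le_of_forall_le hε.le fun x => ?_
        rw [lp.coeFn_sub, Pi.sub_apply, coe_sum_boundedStep u (fun i => φ (node hab N i))]
        -- The tags stay at the unshifted nodes. Shift and mesh are each below `δ / 2`, and the
        -- fixed endpoints keep `[a, b]` covered.
        refine abs_sub_sum_mul_step_sub_le hab ((backShift_mono s).comp (node_mono hab N)) ?_ ?_
          fun i hx => ?_
        · simp only [Function.comp_apply, backShift_of_eq_left (node_zero hab N), node_zero]
        · simp only [Function.comp_apply, backShift_of_eq_right (node_self hab hN0), node_self hab hN0]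
        · have h1 : (u i : ℝ) ≤ x := hx.1
          have h2 : (x : ℝ) ≤ u (i + 1) := hx.2
          have h3 := sub_abs_le_backShift s (node hab N i)
          have h4 : (u (i + 1) : ℝ) ≤ node hab N (i + 1) := backShift_le s _
          rw [abs_of_pos hs.1] at h3
          have h5 := node_succ_sub_le hab N i
          refine h x (node hab N i) (abs_lt.2 ?_)
          constructor <;> linarith [hs.2]

end Extension

theorem exists_rieszRepresents (hab : a < b) (ℓ : StrongDual ℝ C(Icc a b, ℝ)) :
    ∃ g : NBV a b ℝ, RieszRepresents ℓ g ∧ ‖g‖ ≤ ‖ℓ‖ := by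
  obtain ⟨Λ, hΛ, hn⟩ := exists_extension_bounded ℓ
  refine ⟨ofBoundedVariation hab (fun t => Λ (boundedStep t)) boundedVariationOn_boundedStep
    fun t ht => by rw [boundedStep_of_eq_left hab ht, map_zero], fun φ => ?_, ?_⟩
  · rw [← hΛ]
    exact tendsto_nhds_unique (tendsto_riemannSum_leftRegularization hab φ)
      (tendsto_riemannSum_integral hab _ φ)
  · refine (norm_ofBoundedVariation_le hab _ _ _).trans (le_trans ?_ hn)
    exact ENNReal.toReal_le_of_le_ofReal (norm_nonneg _) eVariationOn_boundedStep_le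

theorem existsUnique_rieszRepresents (hab : a < b) (ℓ : StrongDual ℝ C(Icc a b, ℝ)) :
    ∃! g : NBV a b ℝ, RieszRepresents ℓ g := by
  obtain ⟨g, hg, -⟩ := exists_rieszRepresents hab ℓ
  exact ⟨g, hg, fun f hf => ext_of_forall_integral_eq hab fun φ => (hf φ).symm.trans (hg φ)⟩

/-! ### The scalar Riesz operator -/

theorem rieszRepresents_riesz₁ (hab : a < b) (ℓ : StrongDual ℝ C(Icc a b, ℝ)) :
    RieszRepresents ℓ (riesz₁ ℓ) :=
  Classical.epsilon_spec (existsUnique_rieszRepresents hab ℓ).exists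

theorem riesz₁_eq (hab : a < b) {ℓ : StrongDual ℝ C(Icc a b, ℝ)} {g : NBV a b ℝ}
    (hg : RieszRepresents ℓ g) : riesz₁ ℓ = g :=
  (existsUnique_rieszRepresents hab ℓ).unique (rieszRepresents_riesz₁ hab ℓ) hg

theorem norm_riesz₁_le (hab : a < b) (ℓ : StrongDual ℝ C(Icc a b, ℝ)) : ‖riesz₁ ℓ‖ ≤ ‖ℓ‖ := by
  obtain ⟨g, hg, hn⟩ := exists_rieszRepresents hab ℓ
  rwa [riesz₁_eq hab hg]

theorem norm_integralCLM_le (hab : a < b) (g : NBV a b ℝ) : ‖integralCLM hab g‖ ≤ ‖g‖ :=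
  LinearMap.mkContinuous_norm_le _ (norm_nonneg g) _

/-! ### Composition with continuous linear maps -/

section Comp

variable {E F : Type*} [NormedAddCommGroup E] [NormedSpace ℝ E] [NormedAddCommGroup F]
  [NormedSpace ℝ F]

/-- The function `t ↦ A (g t)` for a continuous linear map `A`. -/
noncomputable def mapCLM (A : E →L[ℝ] F) (g : NBV a b E) : NBV a b F :=
  ⟨fun t => A (g t), by
    refine ⟨?_, fun t ht => A.continuous.continuousAt.comp_continuousWithinAt (g.2.2.1 t ht),
      fun t ht => ?_⟩
    · exact ne_top_of_le_ne_top (ENNReal.mul_ne_top ENNReal.coe_ne_top g.2.1)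
        (eVariationOn_clm_comp_le A g.1 univ)
    · simp [g.2.2.2 t ht]⟩

theorem norm_mapCLM_le (A : E →L[ℝ] F) (g : NBV a b E) : ‖mapCLM A g‖ ≤ ‖A‖ * ‖g‖ := by
  refine (ENNReal.toReal_mono (ENNReal.mul_ne_top ENNReal.coe_ne_top g.2.1)
    (eVariationOn_clm_comp_le A g.1 univ)).trans_eq ?_
  rw [ENNReal.toReal_mul]
  rfl

theorem mapCLM_add (A : E →L[ℝ] F) (f g : NBV a b E) :
    mapCLM A (f + g) = mapCLM A f + mapCLM A g :=
  Subtype.ext (funext fun t => map_add A (f t) (g t))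

theorem mapCLM_smul (A : E →L[ℝ] F) (c : ℝ) (g : NBV a b E) :
    mapCLM A (c • g) = c • mapCLM A g :=
  Subtype.ext (funext fun t => map_smul A c (g t))

theorem norm_smulVec_le (γ : NBV a b ℝ) (v : E) : ‖γ.smulVec v‖ ≤ ‖v‖ * ‖γ‖ := by
  refine (norm_mapCLM_le (ContinuousLinearMap.toSpanSingleton ℝ v) γ).trans_eq ?_
  rw [ContinuousLinearMap.norm_toSpanSingleton]

theorem finsetSum_apply {ι : Type*} (s : Finset ι) (g : ι → NBV a b E) (t : Icc a b) :
    (∑ i ∈ s, g i) t = ∑ i ∈ s, g i t := by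
  have h := map_sum (nbvSubmodule a b E).subtype g s
  exact (congrFun h t).trans (Finset.sum_apply _ _ _)

end Comp

/-! ### The vector-valued Riesz operator -/

variable {n : ℕ}

/-- Evaluation of a linear form on `ℝⁿ` at the `k`-th canonical basis vector. -/
noncomputable def evalBasis (k : Fin n) : StrongDual ℝ (Fin n → ℝ) →L[ℝ] ℝ :=
  ContinuousLinearMap.apply ℝ ℝ (Pi.single k 1 : Fin n → ℝ)

/-- The map `φ ↦ φ_k` from `C⁰([a, b], ℝⁿ)` to `C⁰([a, b], ℝ)`. -/
noncomputable def coordinate (a b : ℝ) (k : Fin n) : C(Icc a b, Fin n → ℝ) →L[ℝ] C(Icc a b, ℝ) :=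
  (ContinuousLinearMap.proj (R := ℝ) (φ := fun _ : Fin n => ℝ) k).compLeftContinuous ℝ (Icc a b)

/-- The map `φ ↦ φ e_k` from `C⁰([a, b], ℝ)` to `C⁰([a, b], ℝⁿ)`. -/
noncomputable def basisEmbedding (a b : ℝ) (k : Fin n) :
    C(Icc a b, ℝ) →L[ℝ] C(Icc a b, Fin n → ℝ) :=
  (ContinuousLinearMap.toSpanSingleton ℝ
    (Pi.single k 1 : Fin n → ℝ)).compLeftContinuous ℝ (Icc a b)

theorem coordinate_basisEmbedding (j k : Fin n) (φ : C(Icc a b, ℝ)) :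
    coordinate a b j (basisEmbedding a b k φ) = if j = k then φ else 0 := by
  ext t
  by_cases h : j = k
  · subst h; simp [coordinate, basisEmbedding]
  · simp [coordinate, basisEmbedding, h]

theorem sum_basisEmbedding_coordinate (φ : C(Icc a b, Fin n → ℝ)) :
    ∑ k, basisEmbedding a b k (coordinate a b k φ) = φ := by
  ext t j
  simp [coordinate, basisEmbedding, ContinuousMap.sum_apply, Finset.sum_apply, Pi.single_apply]

/-- The functional `φ ↦ ∑ k, ∫_a^b dg_k(θ) φ_k(θ)` on `C⁰([a, b], ℝⁿ)`. -/
noncomputable def vectorIntegral (hab : a < b) :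
    NBV a b (StrongDual ℝ (Fin n → ℝ)) →ₗ[ℝ] StrongDual ℝ C(Icc a b, Fin n → ℝ) where
  toFun g := ∑ k, (integralCLM hab (mapCLM (evalBasis k) g)).comp (coordinate a b k)
  map_add' f g := by
    rw [← Finset.sum_add_distrib]
    refine Finset.sum_congr rfl fun k _ => ?_
    ext φ
    rw [mapCLM_add]
    exact integral_add_left hab _ _ _
  map_smul' c g := by
    rw [Finset.smul_sum]
    refine Finset.sum_congr rfl fun k _ => ?_
    ext φ
    rw [mapCLM_smul]
    exact integral_smul_left hab _ _ _

theorem vectorIntegral_apply (hab : a < b) (g : NBV a b (StrongDual ℝ (Fin n → ℝ)))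
    (φ : C(Icc a b, Fin n → ℝ)) :
    vectorIntegral hab g φ = ∑ k, (mapCLM (evalBasis k) g).integral (coordinate a b k φ) := by
  change (∑ k, (integralCLM hab (mapCLM (evalBasis k) g)).comp (coordinate a b k)) φ = _
  rw [_root_.sum_apply]
  rfl

theorem norm_vectorIntegral_le (hab : a < b) (g : NBV a b (StrongDual ℝ (Fin n → ℝ))) :
    ‖vectorIntegral hab g‖ ≤
      (∑ k : Fin n, ‖evalBasis k‖ * ‖coordinate (n := n) a b k‖) * ‖g‖ := by
  rw [Finset.sum_mul]
  refine (norm_sum_le Finset.univ fun k =>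
    (integralCLM hab (mapCLM (evalBasis k) g)).comp (coordinate a b k)).trans
      (Finset.sum_le_sum fun k _ => ?_)
  calc _ ≤ ‖integralCLM hab (mapCLM (evalBasis k) g)‖ * ‖coordinate a b k‖ :=
        ContinuousLinearMap.opNorm_comp_le _ _
    _ ≤ (‖evalBasis k‖ * ‖g‖) * ‖coordinate a b k‖ := by
        gcongr
        exact (norm_integralCLM_le hab _).trans (norm_mapCLM_le _ _)
    _ = _ := by ring

theorem mapCLM_evalBasis_riesz (L : StrongDual ℝ C(Icc a b, Fin n → ℝ)) (k : Fin n) :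
    mapCLM (evalBasis k) (riesz L) = riesz₁ (dualComponent L k) := by
  refine Subtype.ext (funext fun t => ?_)
  change evalBasis k ((riesz L) t) = _
  rw [riesz, finsetSum_apply]
  change (∑ j, (riesz₁ (dualComponent L j)) t •
    (ContinuousLinearMap.proj j : StrongDual ℝ (Fin n → ℝ))) (Pi.single k 1) = _
  simp [Pi.single_apply]

theorem vectorIntegral_riesz (hab : a < b) (L : StrongDual ℝ C(Icc a b, Fin n → ℝ)) :
    vectorIntegral hab (riesz L) = L := by
  ext φ
  rw [vectorIntegral_apply]
  conv_rhs => rw [← sum_basisEmbedding_coordinate φ, map_sum]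
  refine Finset.sum_congr rfl fun k _ => ?_
  rw [mapCLM_evalBasis_riesz]
  exact (rieszRepresents_riesz₁ hab _ _).symm

/-- Testing with `φ e_k` kills all other coordinates; scalar uniqueness then makes `riesz` a left
inverse of `vectorIntegral`. -/
theorem rieszRepresents_dualComponent_vectorIntegral (hab : a < b)
    (g : NBV a b (StrongDual ℝ (Fin n → ℝ))) (k : Fin n) :
    RieszRepresents (dualComponent (vectorIntegral hab g) k) (mapCLM (evalBasis k) g) := by
  intro φ
  change vectorIntegral hab g (basisEmbedding a b k φ) = _
  rw [vectorIntegral_apply, Finset.sum_eq_single k]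
  · rw [coordinate_basisEmbedding, if_pos rfl]
  · intro j _ hj
    rw [coordinate_basisEmbedding, if_neg hj]
    exact map_zero (integralCLM hab _)
  · simp

theorem riesz_vectorIntegral (hab : a < b) (g : NBV a b (StrongDual ℝ (Fin n → ℝ))) :
    riesz (vectorIntegral hab g) = g := by
  refine Subtype.ext (funext fun t => ?_)
  rw [riesz, finsetSum_apply]
  ext y
  simp only [riesz₁_eq hab (rieszRepresents_dualComponent_vectorIntegral hab g _)]
  change (∑ j, (g t (Pi.single j 1)) •
    (ContinuousLinearMap.proj j : StrongDual ℝ (Fin n → ℝ))) y = g t y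
  conv_rhs => rw [← Finset.univ_sum_single y, map_sum]
  rw [_root_.sum_apply]
  refine Finset.sum_congr rfl fun k _ => ?_
  have h : (Pi.single k (y k) : Fin n → ℝ) = y k • Pi.single k 1 := by
    rw [← Pi.single_smul, smul_eq_mul, mul_one]
  rw [h, map_smul]
  exact mul_comm _ _

theorem norm_riesz_le (hab : a < b) (L : StrongDual ℝ C(Icc a b, Fin n → ℝ)) :
    ‖riesz L‖ ≤ (∑ k : Fin n, ‖(ContinuousLinearMap.proj k : StrongDual ℝ (Fin n → ℝ))‖ *
      ‖basisEmbedding (n := n) a b k‖) * ‖L‖ := by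
  rw [Finset.sum_mul]
  refine norm_sum_le_of_le _ fun k _ => (norm_smulVec_le _ _).trans ?_
  rw [mul_assoc]
  gcongr
  exact (norm_riesz₁_le hab _).trans ((L.opNorm_comp_le _).trans_eq (mul_comm _ _))

/-- The operator `riesz` as a linear isomorphism. -/
noncomputable def rieszLinearEquiv (n : ℕ) (hab : a < b) :
    StrongDual ℝ C(Icc a b, Fin n → ℝ) ≃ₗ[ℝ] NBV a b (StrongDual ℝ (Fin n → ℝ)) :=
  -- `vectorIntegral` is linear by construction, so `riesz` inherits linearity as its inverse.
  LinearEquiv.symm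
    { vectorIntegral hab with
      invFun := riesz
      left_inv := riesz_vectorIntegral hab
      right_inv := vectorIntegral_riesz hab }

/-- The operator `riesz` as a topological isomorphism. -/
noncomputable def rieszEquiv (n : ℕ) (hab : a < b) :
    StrongDual ℝ C(Icc a b, Fin n → ℝ) ≃L[ℝ] NBV a b (StrongDual ℝ (Fin n → ℝ)) where
  toLinearEquiv := rieszLinearEquiv n hab
  continuous_toFun := AddMonoidHomClass.continuous_of_bound (rieszLinearEquiv n hab) _
    (norm_riesz_le hab)
  continuous_invFun := AddMonoidHomClass.continuous_of_bound (rieszLinearEquiv n hab).symm _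
    (norm_vectorIntegral_le hab)

end NBV

theorem lemma2p1 (n : ℕ) (r : ℝ) (hr : 0 < r) :
    (∀ ℓ : StrongDual ℝ C(Icc (-r) 0, ℝ), ∃! g : NBV (-r) 0 ℝ, RieszRepresents ℓ g) ∧
    ∃ e : StrongDual ℝ C(Icc (-r) 0, Fin n → ℝ) ≃L[ℝ] NBV (-r) 0 (StrongDual ℝ (Fin n → ℝ)),
      ∀ L, e L = riesz L :=
  ⟨NBV.existsUnique_rieszRepresents (neg_neg_of_pos hr),
    NBV.rieszEquiv n (neg_neg_of_pos hr), fun _ => rfl⟩
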